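/- For $\rho>0$ and $x\ge 0$ let $\Gamma(\rho;x)=\int_x^{\infty}e^{-w}w^{\rho-1}\,dw$ denote the upper incomplete gamma function. For $\alpha\in(0,1)$, $\rho>0$, $0<t_1<\dots<t_n$ (with $t_0:=0$) and $\eta_1,\dots,\eta_n\ge 0$ put $$\Phi(\eta_1,\dots,\eta_n;t_1,\dots,t_n)=\frac{1}{\Gamma(\rho)}\,\Gamma\Big(\rho;\ \sum_{k=1}^{n}\Big(\sum_{i=k}^{n}\eta_i\Big)^{\alpha}(t_k-t_{k-1})\Big).$$ A function $f$ of $n$ variables is called completely monotone (CM) if it is $C^\infty$ on $(0,\infty)^n$ and $$(-1)^{k_1+\dots+k_n}\frac{\partial^{k_1+\dots+k_n}f}{\partial z_1^{k_1}\cdots\partial z_n^{k_n}}(z)\ \ge\ 0\qquad\text{for all } k_1,\dots,k_n\ge 0 \text{ and all } z\in(0,\infty)^n .$$ Let $\alpha\in(0,1)$. (a) Let $\rho\in(0,1]$. For every $n$ and all $0<t_1<\dots<t_n$, the function $\Phi(\,\cdot\,;t_1,\dots,t_n)$ is $C^\infty$ on $(0,\infty)^n$, satisfies $\Phi(0,\dots,0;t_1,\dots,t_n)=1$,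 and is completely monotone with respect to $\eta_1,\dots,\eta_n$. There is a unique probability measure $\pi(\,\cdot\,;t_1,\dots,t_n)$ on $[0,\infty)^n$ such that $$\Phi(\eta_1,\dots,\eta_n;t_1,\dots,t_n)=\int_{[0,\infty)^n}e^{-\eta_1x_1-\dots-\eta_nx_n}\,\pi(dx_1,\dots,dx_n;t_1,\dots,t_n)\qquad\text{for all }\eta_1,\dots,\eta_n\ge 0 .$$ (b) Let $\rho\in(0,1]$. The functions $\Phi$ define the finite-dimensional laws of a $[0,\infty)$-valued process $(\mathcal X_{\alpha,\rho}(t))_{t\ge 0}$ (the generalized stable process): there is exactly one consistent (projective) family $(P_J)$ of probability measures $P_J$ on $[0,\infty)^J$, indexed by the finite sets $J\subset[0,\infty)$, such that $P_{\{0\}}$ is the unit mass at $0$ and, for every $n$, all $0<t_1<\dots<t_n$ and all $\eta_1,\dots,\eta_n\ge0$, $$\int e^{-\sum_{k=1}^n\eta_k x_{t_k}}\,P_{\{t_1,\dots,t_n\}}(dx)=\Phi(\eta_1,\dots,\eta_n;t_1,\dots,t_n).$$ (c) In the one-dimensional case $n=1$, for every $\rho>0$ and $t>0$, the function $\eta\mapsto\Phi(\eta;t)=\Gamma(\rho;\eta^{\alpha}t)/\Gamma(\rho)$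 is completely monotone if and only if $\alpha\rho\le 1$. -/

import Mathlib

open MeasureTheory
open scoped NNReal ContDiff

namespace GenStable

noncomputable section

/-- The upper incomplete gamma function `Γ(ρ; x) = ∫_x^∞ e^{-w} w^{ρ-1} dw`
(the integral converges for `ρ > 0` and `x ≥ 0`). -/
def upperGamma (ρ x : ℝ) : ℝ :=
  ∫ w in Set.Ioi x, Real.exp (-w) * w ^ (ρ - 1)

/-- The time increment `t_k - t_{k-1}`, with the convention `t_0 = 0`
(the times `t_1, …, t_n` are indexed by `Fin n`). -/
def increment {n : ℕ} (t : Fin n → ℝ) (k : Fin n) : ℝ :=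
  t k - (Fin.cons 0 t : Fin (n + 1) → ℝ) k.castSucc

/-- The power of the tail sum, `(∑_{i ≥ k} η_i) ^ α`. -/
def Xi {n : ℕ} (α : ℝ) (η : Fin n → ℝ) (k : Fin n) : ℝ :=
  (∑ i ∈ Finset.Ici k, η i) ^ α

/-- `Φ(η_1, …, η_n; t_1, …, t_n) = Γ(ρ; ∑_k (∑_{i ≥ k} η_i)^α (t_k - t_{k-1})) / Γ(ρ)`. -/
def Phi {n : ℕ} (α ρ : ℝ) (t η : Fin n → ℝ) : ℝ :=
  upperGamma ρ (∑ k, Xi α η k * increment t k) / Real.Gamma ρ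

/-- The open octant `(0, ∞)^n`. -/
def openOctant (n : ℕ) : Set (Fin n → ℝ) := {z | ∀ i, 0 < z i}

/-- The partial derivative `∂f/∂z_i`. -/
def partialDeriv {n : ℕ} (i : Fin n) (f : (Fin n → ℝ) → ℝ) : (Fin n → ℝ) → ℝ :=
  fun z => deriv (fun s => f (Function.update z i s)) (z i)

/-- The mixed partial derivative `∂^{k_1 + ⋯ + k_n} f / ∂z_1^{k_1} ⋯ ∂z_n^{k_n}`. -/
def mixedPartial {n : ℕ} (k : Fin n → ℕ) (f : (Fin n → ℝ) → ℝ) : (Fin n → ℝ) → ℝ :=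
  (List.finRange n).foldr (fun i g => (partialDeriv i)^[k i] g) f

/-- Multivariate complete monotonicity on the octant `(0, ∞)^n`: `f` is `C^∞` there and
`(-1)^{k_1 + ⋯ + k_n} ∂^{k_1 + ⋯ + k_n} f / ∂z_1^{k_1} ⋯ ∂z_n^{k_n} ≥ 0`
for all `k_1, …, k_n ≥ 0`. -/
structure CompletelyMonotone {n : ℕ} (f : (Fin n → ℝ) → ℝ) : Prop where
  contDiffOn : ContDiffOn ℝ ∞ f (openOctant n)
  sign : ∀ k : Fin n → ℕ, ∀ z ∈ openOctant n, 0 ≤ (-1 : ℝ) ^ (∑ i, k i) * mixedPartial k f z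

/-- `P` is a consistent family of finite-dimensional laws of a `[0, ∞)`-valued process
`X = (X(s))_{s ≥ 0}` (with `P J` the joint law of `(X(s))_{s ∈ J}`), such that `X(0) = 0` almost
surely and `E exp(-∑_k η_k X(t_k)) = Φ(η_1, …, η_n; t_1, …, t_n)` for all `0 < t_1 < ⋯ < t_n` and
all `η_1, …, η_n ≥ 0`. -/
structure IsGenStableLaws (α ρ : ℝ) (P : ∀ J : Finset ℝ≥0, Measure (J → ℝ≥0)) : Prop where
  isProbabilityMeasure : ∀ J, IsProbabilityMeasure (P J)
  consistent : IsProjectiveMeasureFamily (α := fun _ : ℝ≥0 => ℝ≥0) P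
  zero : ∀ᵐ x ∂(P {0}), x ⟨0, Finset.mem_singleton_self 0⟩ = 0
  laplace : ∀ (n : ℕ) (t : Fin n → ℝ≥0), (∀ k, 0 < t k) → StrictMono t → ∀ η : Fin n → ℝ≥0,
    ∫ x, Real.exp (-∑ k, (η k : ℝ) *
        (x ⟨t k, Finset.mem_image_of_mem t (Finset.mem_univ k)⟩ : ℝ)) ∂(P (Finset.univ.image t))
      = Phi α ρ (fun k => (t k : ℝ)) (fun k => (η k : ℝ))

end

end GenStable

namespace GenStable

open Filter Set Topology
open scoped ENNReal BoundedContinuousFunction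

/-! ### The incomplete gamma function: smoothness and behaviour at `0` and `∞` -/

section UpperGamma

variable {ρ : ℝ}

/-! Minus the derivative of `Γ(ρ; t y^α)` in `y` is `α t^ρ e^{-t y^α} y^{αρ-1}`. If `αρ ≤ 1` and
`e^{-t y^α}` is a Laplace transform, so is its product with `y^{-(1-αρ)}` (convolve with a
gamma-type measure), and integrating over `(η, ∞)` only divides the measure by `x`: this is
`exists_measure_laplace_upperGamma`. Its case `α = 1` needs no stable law and gives, for `ρ ≤ 1`, a
variable `U` with transform `Γ(ρ; η) / Γ(ρ)`. Taking `α` in the role of `ρ`, the same case gives a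
law with `1 - φ(y) ~ y^α / Γ(α+1)` at `0`, whose rescaled i.i.d. sums converge to the stable law
(`exists_stable`).

For (a), run independent stable increments and scale by `U^{1/α}`. Given `U = u` the joint transform
is `e^{-uE}`, with `E` the exponent in `Φ`; averaging over `U` gives `Γ(ρ; E) / Γ(ρ) = Φ`
(`exists_law_of_increments`). Differentiating under the integral gives complete monotonicity, and
`ext_of_laplace` gives uniqueness.

For (b), `E = ∫_0^∞ (∑_{i : u ≤ t_i} η_i)^α du` (`sum_Xi_mul_sub`). A time of weight zero drops out,
so marginals have the right transforms, and uniqueness of transforms yields consistency.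

For (c), sufficiency is the first construction applied to the stable law. If `αρ > 1`, the second
derivative in `η` is negative near `0`. -/

lemma upperGamma_zero (hρ : 0 < ρ) : upperGamma ρ 0 = Real.Gamma ρ :=
  (Real.Gamma_eq_integral hρ).symm

lemma gammaIntegrand_intervalIntegrable (hρ : 0 < ρ) {x : ℝ} (hx : 0 ≤ x) :
    IntervalIntegrable (fun w => Real.exp (-w) * w ^ (ρ - 1)) volume 0 x := by
  rw [intervalIntegrable_iff_integrableOn_Ioc_of_le hx]
  exact (Real.GammaIntegral_convergent hρ).mono_set Ioc_subset_Ioi_self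

lemma upperGamma_eq_sub (hρ : 0 < ρ) {x : ℝ} (hx : 0 ≤ x) :
    upperGamma ρ x = Real.Gamma ρ - ∫ w in (0 : ℝ)..x, Real.exp (-w) * w ^ (ρ - 1) := by
  have h := intervalIntegral.integral_interval_add_Ioi (μ := volume)
    (Real.GammaIntegral_convergent hρ)
    ((Real.GammaIntegral_convergent hρ).mono_set (Ioi_subset_Ioi hx))
  rw [Real.Gamma_eq_integral hρ, ← h, upperGamma]
  ring

lemma upperGamma_nonneg {x : ℝ} (hx : 0 ≤ x) : 0 ≤ upperGamma ρ x :=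
  setIntegral_nonneg measurableSet_Ioi fun _ hw =>
    mul_nonneg (Real.exp_pos _).le (Real.rpow_nonneg (hx.trans (le_of_lt hw)) _)

lemma hasDerivAt_upperGamma (hρ : 0 < ρ) {x : ℝ} (hx : 0 < x) :
    HasDerivAt (upperGamma ρ) (-(Real.exp (-x) * x ^ (ρ - 1))) x := by
  have hc : ContinuousOn (fun w : ℝ => Real.exp (-w) * w ^ (ρ - 1)) (Ioi 0) := fun w hw =>
    ((by fun_prop : ContinuousAt (fun w : ℝ => Real.exp (-w)) w).mul
      (Real.continuousAt_rpow_const _ _ (Or.inl (ne_of_gt hw)))).continuousWithinAt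
  have h := (intervalIntegral.integral_hasDerivAt_right
    (gammaIntegrand_intervalIntegrable hρ hx.le)
    (hc.stronglyMeasurableAtFilter isOpen_Ioi x hx)
    (hc.continuousAt (Ioi_mem_nhds hx))).const_sub (Real.Gamma ρ)
  refine h.congr_of_eventuallyEq ?_
  filter_upwards [Ioi_mem_nhds hx] with y hy using upperGamma_eq_sub hρ (le_of_lt hy)

lemma continuousOn_upperGamma (hρ : 0 < ρ) : ContinuousOn (upperGamma ρ) (Ici 0) := by
  intro x hx
  have hx' : (0 : ℝ) ≤ x + 1 := by linarith [mem_Ici.1 hx]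
  have h := intervalIntegral.continuousOn_primitive_interval (μ := volume) (a := 0) (b := x + 1)
    (f := fun w => Real.exp (-w) * w ^ (ρ - 1)) (by
      rw [uIcc_of_le hx', integrableOn_Icc_iff_integrableOn_Ioc]
      exact (Real.GammaIntegral_convergent hρ).mono_set Ioc_subset_Ioi_self)
  rw [uIcc_of_le hx'] at h
  have h2 : ContinuousWithinAt (fun x => Real.Gamma ρ -
      ∫ w in (0 : ℝ)..x, Real.exp (-w) * w ^ (ρ - 1)) (Ici 0) x :=
    (continuousWithinAt_const.sub (h x ⟨hx, by linarith⟩)).mono_of_mem_nhdsWithin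
      (by
        rw [← Ici_inter_Iic]
        exact inter_mem_nhdsWithin _ (Iic_mem_nhds (by linarith)))
  exact h2.congr (fun y hy => upperGamma_eq_sub hρ hy) (upperGamma_eq_sub hρ hx)

lemma tendsto_upperGamma_atTop (hρ : 0 < ρ) : Tendsto (upperGamma ρ) atTop (𝓝 0) := by
  have h := (intervalIntegral_tendsto_integral_Ioi (μ := volume) 0
    (Real.GammaIntegral_convergent hρ) tendsto_id).const_sub (Real.Gamma ρ)
  rw [← Real.Gamma_eq_integral hρ, sub_self] at h
  refine h.congr' ?_
  filter_upwards [eventually_ge_atTop 0] with x hx using (upperGamma_eq_sub hρ hx).symm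

lemma contDiffOn_upperGamma (hρ : 0 < ρ) : ContDiffOn ℝ ∞ (upperGamma ρ) (Ioi 0) := by
  refine (contDiffOn_infty_iff_deriv_of_isOpen isOpen_Ioi).2
    ⟨fun x hx => (hasDerivAt_upperGamma hρ hx).differentiableAt.differentiableWithinAt, ?_⟩
  have h : ContDiffOn ℝ ∞ (fun x : ℝ => -(Real.exp (-x) * x ^ (ρ - 1))) (Ioi 0) := fun x hx =>
    (((Real.contDiff_exp.comp contDiff_neg).contDiffAt.mul
      (Real.contDiffAt_rpow_const_of_ne (ne_of_gt hx))).neg).contDiffWithinAt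
  exact h.congr fun x hx => (hasDerivAt_upperGamma hρ hx).deriv

/-- Bound `e^{-w}` by `1`. Together with the bound by `e^{-x}` from below in
`le_one_sub_upperGamma`, this pins down the `x^ρ / Γ(ρ+1)` behaviour at `0` that produces the stable
limit. -/
lemma one_sub_upperGamma_le (hρ : 0 < ρ) {x : ℝ} (hx : 0 ≤ x) :
    1 - upperGamma ρ x / Real.Gamma ρ ≤ x ^ ρ / Real.Gamma (ρ + 1) := by
  have hG := Real.Gamma_pos_of_pos hρ
  have h : ∫ w in (0 : ℝ)..x, Real.exp (-w) * w ^ (ρ - 1) ≤ x ^ ρ / ρ := by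
    have h1 := intervalIntegral.integral_mono_on hx (gammaIntegrand_intervalIntegrable hρ hx)
      (intervalIntegral.intervalIntegrable_rpow' (r := ρ - 1) (by linarith)) (fun w hw => by
        have : Real.exp (-w) ≤ 1 := Real.exp_le_one_iff.2 (by linarith [hw.1])
        have := mul_le_mul_of_nonneg_right this (Real.rpow_nonneg hw.1 (ρ - 1))
        simpa using this)
    rwa [integral_rpow (Or.inl (by linarith)), sub_add_cancel, Real.zero_rpow hρ.ne',
      sub_zero] at h1
  rw [upperGamma_eq_sub hρ hx, Real.Gamma_add_one hρ.ne', sub_div, div_self hG.ne', sub_sub_cancel,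
    ← div_div]
  gcongr

lemma le_one_sub_upperGamma (hρ : 0 < ρ) {x : ℝ} (hx : 0 ≤ x) :
    Real.exp (-x) * x ^ ρ / Real.Gamma (ρ + 1) ≤ 1 - upperGamma ρ x / Real.Gamma ρ := by
  have hG := Real.Gamma_pos_of_pos hρ
  have h : Real.exp (-x) * x ^ ρ / ρ ≤ ∫ w in (0 : ℝ)..x, Real.exp (-w) * w ^ (ρ - 1) := by
    have h1 := intervalIntegral.integral_mono_on hx
      ((intervalIntegral.intervalIntegrable_rpow' (r := ρ - 1) (by linarith)).const_mul
        (Real.exp (-x))) (gammaIntegrand_intervalIntegrable hρ hx) (fun w hw => by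
        have : Real.exp (-x) ≤ Real.exp (-w) := Real.exp_le_exp.2 (by linarith [hw.2])
        exact mul_le_mul_of_nonneg_right this (Real.rpow_nonneg hw.1 (ρ - 1)))
    rwa [intervalIntegral.integral_const_mul, integral_rpow (Or.inl (by linarith)),
      sub_add_cancel, Real.zero_rpow hρ.ne', sub_zero, ← mul_div_assoc] at h1
  rw [upperGamma_eq_sub hρ hx, Real.Gamma_add_one hρ.ne', sub_div, div_self hG.ne', sub_sub_cancel,
    ← div_div]
  gcongr

/-- The derivative of `y ↦ Γ(ρ; t y^α)`. -/
lemma hasDerivAt_upperGamma_rpow {α t : ℝ} (hρ : 0 < ρ) (ht : 0 < t) {y : ℝ}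
    (hy : 0 < y) : HasDerivAt (fun y => upperGamma ρ (t * y ^ α))
      (-(α * t ^ ρ * (Real.exp (-(t * y ^ α)) * y ^ (α * ρ - 1)))) y := by
  have hp : 0 < y ^ α := Real.rpow_pos_of_pos hy _
  have h := (hasDerivAt_upperGamma hρ (mul_pos ht hp)).comp y
    ((Real.hasDerivAt_rpow_const (p := α) (Or.inl hy.ne')).const_mul t)
  convert! h using 1
  have e1 : (t * y ^ α) ^ (ρ - 1) = t ^ (ρ - 1) * y ^ (α * (ρ - 1)) := by
    rw [Real.mul_rpow ht.le hp.le, ← Real.rpow_mul hy.le]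
  have e2 : t ^ ρ = t ^ (ρ - 1) * t := by
    rw [← Real.rpow_add_one ht.ne', sub_add_cancel]
  have e3 : y ^ (α * ρ - 1) = y ^ (α * (ρ - 1)) * y ^ (α - 1) := by
    rw [← Real.rpow_add hy]; congr 1; ring
  rw [e1, e2, e3]
  ring

end UpperGamma

/-! ### Incomplete gamma functions as Laplace transforms -/

section Representation

lemma measurable_exp_neg_mul (y : ℝ) :
    Measurable fun x : ℝ≥0 => ENNReal.ofReal (Real.exp (-(y * x))) := by fun_prop

/-- `y ↦ y^{-p}` is a Laplace transform for every `p ≥ 0`. -/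
lemma exists_measure_laplace_rpow_neg {p : ℝ} (hp : 0 ≤ p) :
    ∃ κ : Measure ℝ≥0, SFinite κ ∧ ∀ y : ℝ, 0 < y →
      ∫⁻ s : ℝ≥0, ENNReal.ofReal (Real.exp (-(y * s))) ∂κ = ENNReal.ofReal (y ^ (-p)) := by
  rcases hp.eq_or_lt with rfl | hp
  · exact ⟨Measure.dirac 0, inferInstance, fun y hy => by
      rw [lintegral_dirac' _ (measurable_exp_neg_mul y)]; simp⟩
  have hG := Real.Gamma_pos_of_pos hp
  refine ⟨((volume.restrict (Ioi (0 : ℝ))).withDensity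
    (fun s => ENNReal.ofReal (s ^ (p - 1) / Real.Gamma p))).map Real.toNNReal, inferInstance,
    fun y hy => ?_⟩
  rw [lintegral_map (measurable_exp_neg_mul y) measurable_real_toNNReal,
    lintegral_withDensity_eq_lintegral_mul _ (by fun_prop) (by fun_prop)]
  have hint : IntegrableOn (fun s : ℝ => s ^ (p - 1) * Real.exp (-(y * s)) / Real.Gamma p)
      (Ioi 0) := by
    refine Integrable.div_const ?_ _
    by_contra h
    have h1 := Real.integral_rpow_mul_exp_neg_mul_Ioi hp hy
    rw [integral_undef h] at h1
    have : 0 < (1 / y) ^ p * Real.Gamma p := by positivity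
    exact this.ne h1
  have hval : ∫ s in Ioi (0 : ℝ), s ^ (p - 1) * Real.exp (-(y * s)) / Real.Gamma p
      = y ^ (-p) := by
    rw [integral_div, Real.integral_rpow_mul_exp_neg_mul_Ioi hp hy, mul_div_assoc,
      div_self hG.ne', mul_one, one_div, Real.inv_rpow hy.le, Real.rpow_neg hy.le]
  rw [← hval, ofReal_integral_eq_lintegral_ofReal hint]
  · refine setLIntegral_congr_fun measurableSet_Ioi fun s hs => ?_
    have hs : 0 < s := hs
    have : 0 ≤ s ^ (p - 1) / Real.Gamma p := by positivity
    simp only [Pi.mul_apply]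
    rw [← ENNReal.ofReal_mul this, Real.coe_toNNReal _ hs.le]
    congr 1; ring
  · filter_upwards [ae_restrict_mem measurableSet_Ioi] with s hs
    have hs : 0 < s := hs
    have : 0 ≤ s ^ (p - 1) * Real.exp (-(y * s)) / Real.Gamma p := by positivity
    simpa using this

lemma lintegral_exp_neg_mul_map_add {τ κ : Measure ℝ≥0} [SFinite τ] [SFinite κ] (y : ℝ) :
    ∫⁻ x : ℝ≥0, ENNReal.ofReal (Real.exp (-(y * x))) ∂((τ.prod κ).map fun q => q.1 + q.2)
      = (∫⁻ x : ℝ≥0, ENNReal.ofReal (Real.exp (-(y * x))) ∂τ)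
        * ∫⁻ x : ℝ≥0, ENNReal.ofReal (Real.exp (-(y * x))) ∂κ := by
  rw [lintegral_map (measurable_exp_neg_mul y) (by fun_prop),
    ← lintegral_prod_mul (measurable_exp_neg_mul y).aemeasurable
      (measurable_exp_neg_mul y).aemeasurable]
  refine lintegral_congr fun q => ?_
  rw [← ENNReal.ofReal_mul (Real.exp_pos _).le, ← Real.exp_add]
  congr 2; push_cast; ring

/-- Integrating a Laplace transform over `(η, ∞)` divides the measure by `x`. -/
lemma exists_measure_laplace_integral_Ioi (m : Measure ℝ≥0) [SFinite m] :
    ∃ m' : Measure ℝ≥0, ∀ η : ℝ,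
      ∫⁻ x : ℝ≥0, ENNReal.ofReal (Real.exp (-(η * x))) ∂m'
        = ∫⁻ y in Ioi η, ∫⁻ x : ℝ≥0, ENNReal.ofReal (Real.exp (-(y * x))) ∂m := by
  have hm : Measurable fun q : ℝ≥0 × ℝ => ENNReal.ofReal (Real.exp (-(q.2 * q.1))) := by fun_prop
  have hD : Measurable fun x : ℝ≥0 =>
      ∫⁻ y in Ioi (0 : ℝ), ENNReal.ofReal (Real.exp (-(y * x))) := hm.lintegral_prod_right'
  -- The density is `1 / x`, kept as an integral so that its value `∞` at `x = 0` needs no separate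
  -- case.
  refine ⟨m.withDensity fun x => ∫⁻ y in Ioi (0 : ℝ), ENNReal.ofReal (Real.exp (-(y * x))),
    fun η => ?_⟩
  rw [lintegral_withDensity_eq_lintegral_mul _ hD (measurable_exp_neg_mul η),
    lintegral_lintegral_swap (f := fun (y : ℝ) (x : ℝ≥0) => ENNReal.ofReal (Real.exp (-(y * x))))
      (hm.comp measurable_swap).aemeasurable]
  refine lintegral_congr fun x => ?_
  have h : ∫⁻ y in Ioi η, ENNReal.ofReal (Real.exp (-(y * x)))
      = ∫⁻ y in Ioi (0 : ℝ), ENNReal.ofReal (Real.exp (-((y + η) * x))) := by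
    rw [← lintegral_indicator measurableSet_Ioi, ← lintegral_indicator measurableSet_Ioi,
      ← lintegral_add_right_eq_self _ η]
    refine lintegral_congr fun y => ?_
    simp [indicator]
  rw [h, Pi.mul_apply, ← lintegral_mul_const _ (by fun_prop)]
  refine lintegral_congr fun y => ?_
  rw [← ENNReal.ofReal_mul (Real.exp_pos _).le, ← Real.exp_add]
  congr 2; ring

lemma integral_exp_neg_mul_eq {m : Measure ℝ≥0} {y c : ℝ} (hc : 0 ≤ c)
    (h : ∫⁻ x : ℝ≥0, ENNReal.ofReal (Real.exp (-(y * x))) ∂m = ENNReal.ofReal c) :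
    ∫ x : ℝ≥0, Real.exp (-(y * x)) ∂m = c := by
  rw [integral_eq_lintegral_of_nonneg_ae (ae_of_all _ fun _ => (Real.exp_pos _).le) (by fun_prop),
    h, ENNReal.toReal_ofReal hc]

lemma lintegral_exp_neg_mul_eq {m : Measure ℝ≥0} [IsFiniteMeasure m] {y : ℝ} (hy : 0 ≤ y) :
    ∫⁻ x : ℝ≥0, ENNReal.ofReal (Real.exp (-(y * x))) ∂m
      = ENNReal.ofReal (∫ x : ℝ≥0, Real.exp (-(y * x)) ∂m) := by
  refine (ofReal_integral_eq_lintegral_ofReal ?_ (ae_of_all _ fun _ => (Real.exp_pos _).le)).symm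
  refine Integrable.of_bound (by fun_prop) 1 (ae_of_all _ fun x => ?_)
  rw [Real.norm_eq_abs, abs_of_pos (Real.exp_pos _)]
  exact Real.exp_le_one_iff.2 (neg_nonpos.2 (mul_nonneg hy x.2))

/-- Fundamental theorem of calculus on `(η, ∞)` for a decreasing function vanishing at `∞`. At `η =
0` only one-sided continuity is available, and it suffices. -/
lemma lintegral_rpow_Ioi_eq_upperGamma {α ρ t : ℝ} (hα : 0 < α) (hρ : 0 < ρ) (ht : 0 < t)
    {η : ℝ} (hη : 0 ≤ η) :
    ∫⁻ y in Ioi η, ENNReal.ofReal (α * t ^ ρ * (Real.exp (-(t * y ^ α)) * y ^ (α * ρ - 1)))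
      = ENNReal.ofReal (upperGamma ρ (t * η ^ α)) := by
  have hpos : ∀ y ∈ Ioi η, 0 < y := fun y hy => lt_of_le_of_lt hη hy
  have hcont : ContinuousWithinAt (fun y => upperGamma ρ (t * y ^ α)) (Ici η) η := by
    refine (continuousOn_upperGamma hρ _ (by positivity : 0 ≤ t * η ^ α)).comp
      (t := Ici 0) (f := fun y : ℝ => t * y ^ α)
      ((Real.continuousAt_rpow_const _ _ (Or.inr hα.le)).const_mul t).continuousWithinAt ?_
    exact fun y hy => mul_nonneg ht.le (Real.rpow_nonneg (hη.trans hy) _)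
  have hlim : Tendsto (fun y => upperGamma ρ (t * y ^ α)) atTop (𝓝 0) :=
    (tendsto_upperGamma_atTop hρ).comp ((tendsto_rpow_atTop hα).const_mul_atTop ht)
  have hnp : ∀ y ∈ Ioi η,
      -(α * t ^ ρ * (Real.exp (-(t * y ^ α)) * y ^ (α * ρ - 1))) ≤ 0 := fun y hy => by
    have := hpos y hy
    have : 0 ≤ α * t ^ ρ * (Real.exp (-(t * y ^ α)) * y ^ (α * ρ - 1)) := by positivity
    linarith
  have hd := fun y hy => hasDerivAt_upperGamma_rpow (α := α) hρ ht (hpos y hy)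
  have hi := integrableOn_Ioi_deriv_of_nonpos hcont hd hnp hlim
  have hv := integral_Ioi_of_hasDerivAt_of_nonpos hcont hd hnp hlim
  rw [integral_neg, zero_sub, neg_inj] at hv
  rw [← hv, ofReal_integral_eq_lintegral_ofReal]
  · simpa [IntegrableOn] using hi.neg
  · filter_upwards [ae_restrict_mem measurableSet_Ioi] with y hy
    simpa using hnp y hy

/-- If `e^{-t y^α}` is a Laplace transform and `α ρ ≤ 1`, then `Γ(ρ; t η^α) / Γ(ρ)` is the Laplace
transform of a probability measure. -/
theorem exists_measure_laplace_upperGamma {α ρ t : ℝ} (hα : 0 < α) (hρ : 0 < ρ) (ht : 0 < t)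
    (hαρ : α * ρ ≤ 1) {τ : Measure ℝ≥0} [IsProbabilityMeasure τ]
    (hτ : ∀ y : ℝ, 0 < y → ∫ x : ℝ≥0, Real.exp (-(y * x)) ∂τ = Real.exp (-(t * y ^ α))) :
    ∃ m : Measure ℝ≥0, IsProbabilityMeasure m ∧ ∀ η : ℝ, 0 ≤ η →
      ∫ x : ℝ≥0, Real.exp (-(η * x)) ∂m = upperGamma ρ (t * η ^ α) / Real.Gamma ρ := by
  have hG := Real.Gamma_pos_of_pos hρ
  obtain ⟨κ, hκ, hκy⟩ := exists_measure_laplace_rpow_neg (p := 1 - α * ρ) (by linarith)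
  obtain ⟨m, hm⟩ := exists_measure_laplace_integral_Ioi
    (((τ.prod κ).map fun q => q.1 + q.2))
  have hc : 0 ≤ α * t ^ ρ := by positivity
  have key : ∀ η : ℝ, 0 ≤ η → ∫⁻ x : ℝ≥0, ENNReal.ofReal (Real.exp (-(η * x)))
      ∂(ENNReal.ofReal (α * t ^ ρ / Real.Gamma ρ) • m)
        = ENNReal.ofReal (upperGamma ρ (t * η ^ α) / Real.Gamma ρ) := by
    intro η hη
    rw [lintegral_smul_measure, hm, smul_eq_mul, div_eq_inv_mul,
      ENNReal.ofReal_mul (inv_nonneg.2 hG.le), mul_assoc, div_eq_inv_mul,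
      ENNReal.ofReal_mul (inv_nonneg.2 hG.le), ← lintegral_rpow_Ioi_eq_upperGamma hα hρ ht hη,
      ← lintegral_const_mul' _ _ ENNReal.ofReal_ne_top]
    congr 1
    refine setLIntegral_congr_fun measurableSet_Ioi fun y hy => ?_
    have hy : 0 < y := lt_of_le_of_lt hη hy
    rw [lintegral_exp_neg_mul_map_add, lintegral_exp_neg_mul_eq hy.le, hτ y hy, hκy y hy,
      ← ENNReal.ofReal_mul (Real.exp_pos _).le, ← ENNReal.ofReal_mul hc, neg_sub]
  refine ⟨ENNReal.ofReal (α * t ^ ρ / Real.Gamma ρ) • m, ⟨?_⟩, fun η hη =>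
    integral_exp_neg_mul_eq (div_nonneg (upperGamma_nonneg (by positivity)) hG.le) (key η hη)⟩
  -- The total mass is the transform at `0`, namely `Γ(ρ; 0) / Γ(ρ) = 1`.
  have h0 := key 0 le_rfl
  rw [Real.zero_rpow hα.ne', mul_zero, upperGamma_zero hρ, div_self hG.ne'] at h0
  simpa using h0

lemma exists_measure_laplace_upperGamma_of_le_one {ρ : ℝ} (hρ : 0 < ρ) (hρ1 : ρ ≤ 1) :
    ∃ m : Measure ℝ≥0, IsProbabilityMeasure m ∧ ∀ η : ℝ, 0 ≤ η →
      ∫ x : ℝ≥0, Real.exp (-(η * x)) ∂m = upperGamma ρ η / Real.Gamma ρ := by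
  obtain ⟨m, hm, h⟩ := exists_measure_laplace_upperGamma (α := 1) (t := 1) one_pos hρ one_pos
    (by simpa using hρ1) (τ := Measure.dirac 1) (fun y _ => by
      rw [integral_dirac]; simp)
  exact ⟨m, hm, fun η hη => by simpa using h η hη⟩

end Representation

/-! ### The one-sided stable law as a limit of normalized sums -/

section Stable

lemma integrable_exp_neg_mul (m : Measure ℝ≥0) [IsFiniteMeasure m] {y : ℝ} (hy : 0 ≤ y) :
    Integrable (fun x : ℝ≥0 => Real.exp (-(y * x))) m := by
  refine Integrable.of_bound (by fun_prop) 1 (ae_of_all _ fun x => ?_)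
  rw [Real.norm_eq_abs, abs_of_pos (Real.exp_pos _)]
  exact Real.exp_le_one_iff.2 (neg_nonpos.2 (mul_nonneg hy x.2))

/-- Markov's inequality for the tail of a measure in terms of its Laplace transform. -/
lemma measureReal_compl_Iic_le (m : Measure ℝ≥0) [IsProbabilityMeasure m] {R : ℝ≥0} (hR : 0 < R) :
    (1 - Real.exp (-1)) * m.real (Iic R)ᶜ ≤ 1 - ∫ x : ℝ≥0, Real.exp (-((R : ℝ)⁻¹ * x)) ∂m := by
  have hR' : (0 : ℝ) < R := hR
  have hi := integrable_exp_neg_mul m (inv_nonneg.2 hR'.le)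
  have h := mul_meas_ge_le_integral_of_nonneg (μ := m)
    (f := fun x : ℝ≥0 => 1 - Real.exp (-((R : ℝ)⁻¹ * x))) (ae_of_all _ fun x => by
      have : Real.exp (-((R : ℝ)⁻¹ * x)) ≤ 1 := Real.exp_le_one_iff.2 (by
        have : 0 ≤ (R : ℝ)⁻¹ * x := by positivity
        linarith)
      simpa using this) ((integrable_const _).sub hi) (1 - Real.exp (-1))
  rw [integral_sub (integrable_const _) hi] at h
  simp only [integral_const, probReal_univ, one_smul] at h
  refine le_trans (mul_le_mul_of_nonneg_left (measureReal_mono fun x hx => ?_) ?_) h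
  · have hx : (R : ℝ) < x := by simpa using hx
    have : 1 ≤ (R : ℝ)⁻¹ * x := by
      rw [inv_mul_eq_div, one_le_div hR']; exact hx.le
    have := Real.exp_le_exp.2 (neg_le_neg this)
    simp only [mem_ofPred_eq]
    linarith
  · have := Real.exp_le_one_iff.2 (by norm_num : (-1 : ℝ) ≤ 0)
    linarith

/-- A pointwise limit of Laplace transforms which is equicontinuous at `0` is a Laplace
transform. -/
theorem exists_measure_of_tendsto_laplace {μ : ℕ → ProbabilityMeasure ℝ≥0} {g b : ℝ → ℝ}
    (hlim : ∀ y : ℝ, 0 ≤ y → Tendsto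
      (fun n => ∫ x : ℝ≥0, Real.exp (-(y * x)) ∂(μ n : Measure ℝ≥0)) atTop (𝓝 (g y)))
    (hb : Tendsto b (𝓝[>] 0) (𝓝 0))
    (hle : ∀ n, ∀ y : ℝ, 0 < y → 1 - ∫ x : ℝ≥0, Real.exp (-(y * x)) ∂(μ n : Measure ℝ≥0) ≤ b y) :
    ∃ m : Measure ℝ≥0, IsProbabilityMeasure m ∧ ∀ y : ℝ, 0 ≤ y →
      ∫ x : ℝ≥0, Real.exp (-(y * x)) ∂m = g y := by
  have he : 0 < 1 - Real.exp (-1) := by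
    have := Real.exp_lt_exp.2 (by norm_num : (-1 : ℝ) < 0)
    rw [Real.exp_zero] at this
    linarith
  have htight : IsTightMeasureSet {((ν : ProbabilityMeasure ℝ≥0) : Measure ℝ≥0) | ν ∈ range μ} := by
    rw [isTightMeasureSet_iff_exists_isCompact_measure_compl_le]
    intro ε hε
    rcases eq_or_ne ε ∞ with rfl | hε'
    · exact ⟨∅, isCompact_empty, fun _ _ => le_top⟩
    have hε0 : 0 < ε.toReal := ENNReal.toReal_pos hε.ne' hε'
    -- Choose `y` with `b y < (1 - e⁻¹) ε`; Markov's inequality at radius `1 / y` then bounds all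
    -- tails by `ε`.
    obtain ⟨y, hy, hy0⟩ := ((hb.eventually_lt_const (mul_pos he hε0)).and
      self_mem_nhdsWithin).exists
    have hy0 : 0 < y := hy0
    refine ⟨Iic (y⁻¹.toNNReal), ?_, ?_⟩
    · rw [← Icc_bot]; exact isCompact_Icc
    · rintro _ ⟨_, ⟨n, rfl⟩, rfl⟩
      have hR : 0 < y⁻¹.toNNReal := Real.toNNReal_pos.2 (inv_pos.2 hy0)
      have h1 := measureReal_compl_Iic_le (μ n : Measure ℝ≥0) hR
      rw [Real.coe_toNNReal _ (inv_nonneg.2 hy0.le), inv_inv] at h1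
      have h2 := (h1.trans (hle n y hy0)).trans hy.le
      exact (ENNReal.le_ofReal_iff_toReal_le (measure_ne_top _ _) hε0.le).2
        (le_of_mul_le_mul_left h2 he) |>.trans (by rw [ENNReal.ofReal_toReal hε'])
  have hcomp := isCompact_closure_of_isTightMeasureSet htight
  -- A limit along a free ultrafilter replaces a convergent subsequence; the transforms converge
  -- along `atTop`, hence also along it.
  obtain ⟨ν, -, hν : Tendsto μ (hyperfilter ℕ) (𝓝 ν)⟩ :=
    hcomp.ultrafilter_le_nhds ((hyperfilter ℕ).map μ)
    (le_principal_iff.2 (by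
      rw [Ultrafilter.mem_coe, Ultrafilter.mem_map]
      exact univ_mem' fun n => subset_closure (mem_range_self n)))
  refine ⟨ν, inferInstance, fun y hy => ?_⟩
  rw [ProbabilityMeasure.tendsto_iff_forall_integral_tendsto] at hν
  have hb1 : ∀ x : ℝ≥0, ‖Real.exp (-(y * x))‖ ≤ 1 := fun x => by
    rw [Real.norm_eq_abs, abs_of_pos (Real.exp_pos _)]
    exact Real.exp_le_one_iff.2 (neg_nonpos.2 (mul_nonneg hy x.2))
  exact tendsto_nhds_unique
    (hν (BoundedContinuousFunction.ofNormedAddCommGroup _ (by fun_prop) 1 hb1))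
    ((hlim y hy).mono_left (Nat.hyperfilter_le_atTop))

lemma integral_exp_neg_mul_sum (m : Measure ℝ≥0) [IsProbabilityMeasure m] (n : ℕ) (c : ℝ≥0)
    (y : ℝ) :
    ∫ x : ℝ≥0, Real.exp (-(y * x)) ∂((Measure.pi fun _ : Fin n => m).map fun x => c * ∑ i, x i)
      = (∫ x : ℝ≥0, Real.exp (-(y * c * x)) ∂m) ^ n := by
  rw [integral_map (by fun_prop) (by fun_prop)]
  have h := integral_fintype_prod_eq_pow (ι := Fin n) (μ := m)
    (fun x : ℝ≥0 => Real.exp (-(y * c * x)))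
  rw [Fintype.card_fin] at h
  rw [← h]
  refine integral_congr_ae (ae_of_all _ fun x => ?_)
  simp only
  rw [← Real.exp_sum]
  congr 1
  push_cast
  rw [Finset.sum_neg_distrib, ← Finset.mul_sum, mul_assoc]

/-- The one-sided stable law. -/
theorem exists_stable {α : ℝ} (hα₀ : 0 < α) (hα₁ : α < 1) :
    ∃ m : Measure ℝ≥0, IsProbabilityMeasure m ∧ ∀ y : ℝ, 0 ≤ y →
      ∫ x : ℝ≥0, Real.exp (-(y * x)) ∂m = Real.exp (-y ^ α) := by
  obtain ⟨m, hm, hmy⟩ := exists_measure_laplace_upperGamma_of_le_one hα₀ hα₁.le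
  have hG : 0 < Real.Gamma (α + 1) := Real.Gamma_pos_of_pos (by linarith)
  set φ : ℝ → ℝ := fun y => upperGamma α y / Real.Gamma α with hφ
  -- Normalized so that `(n + 1) (1 - φ(y c_n)) → y^α`.
  set c : ℕ → ℝ≥0 := fun n => ((Real.Gamma (α + 1) / (n + 1)) ^ (α⁻¹)).toNNReal with hc
  have hcpos : ∀ n : ℕ, 0 < Real.Gamma (α + 1) / (n + 1) := fun n => by positivity
  have hc' : ∀ n, (c n : ℝ) = (Real.Gamma (α + 1) / (n + 1)) ^ (α⁻¹) := fun n =>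
    Real.coe_toNNReal _ (Real.rpow_nonneg (hcpos n).le _)
  have hpow : ∀ (n : ℕ) (y : ℝ), 0 ≤ y →
      (n + 1) * ((y * c n) ^ α / Real.Gamma (α + 1)) = y ^ α := fun n y hy => by
    rw [Real.mul_rpow hy (c n).coe_nonneg, hc', ← Real.rpow_mul (hcpos n).le, inv_mul_cancel₀ hα₀.ne',
      Real.rpow_one]
    have : (n + 1 : ℝ) ≠ 0 := by positivity
    field_simp
  have hc0 : Tendsto (fun n => (c n : ℝ)) atTop (𝓝 0) := by
    have h1 : Tendsto (fun n : ℕ => Real.Gamma (α + 1) / (n + 1 : ℝ)) atTop (𝓝 0) :=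
      tendsto_const_nhds.div_atTop
        (tendsto_atTop_add_const_right _ _ tendsto_natCast_atTop_atTop)
    have h2 := ((Real.continuousAt_rpow_const 0 α⁻¹ (Or.inr (by positivity))).tendsto).comp h1
    rw [Real.zero_rpow (by positivity)] at h2
    exact h2.congr fun n => (hc' n).symm
  have hup : ∀ (n : ℕ) (y : ℝ), 0 ≤ y → (n + 1) * (1 - φ (y * c n)) ≤ y ^ α := fun n y hy => by
    rw [← hpow n y hy]
    exact mul_le_mul_of_nonneg_left (one_sub_upperGamma_le hα₀ (mul_nonneg hy (c n).coe_nonneg))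
      (by positivity)
  have hlow : ∀ (n : ℕ) (y : ℝ), 0 ≤ y →
      Real.exp (-(y * c n)) * y ^ α ≤ (n + 1) * (1 - φ (y * c n)) := fun n y hy => by
    have h := mul_le_mul_of_nonneg_left
      (le_one_sub_upperGamma hα₀ (mul_nonneg hy (c n).coe_nonneg)) (by positivity : (0 : ℝ) ≤ n + 1)
    rw [← hpow n y hy]
    convert! h using 1
    ring
  have hlim : ∀ y : ℝ, 0 ≤ y → Tendsto (fun n : ℕ => (n + 1 : ℝ) * (1 - φ (y * c n))) atTop
      (𝓝 (y ^ α)) := fun y hy => by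
    refine tendsto_of_tendsto_of_tendsto_of_le_of_le ?_ tendsto_const_nhds
      (fun n => hlow n y hy) (fun n => hup n y hy)
    have h := ((Real.continuous_exp.tendsto _).comp (hc0.const_mul y).neg).mul_const (y ^ α)
    simpa using h
  let μ : ℕ → ProbabilityMeasure ℝ≥0 := fun n =>
    ⟨(Measure.pi fun _ : Fin (n + 1) => m).map fun x => c n * ∑ i, x i,
      Measure.isProbabilityMeasure_map (by fun_prop)⟩
  have hμ : ∀ (n : ℕ) (y : ℝ), 0 ≤ y →
      ∫ x : ℝ≥0, Real.exp (-(y * x)) ∂(μ n : Measure ℝ≥0) = φ (y * c n) ^ (n + 1) :=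
    fun n y hy => by
      refine (integral_exp_neg_mul_sum m (n + 1) (c n) y).trans ?_
      rw [hmy _ (mul_nonneg hy (c n).coe_nonneg)]
  refine exists_measure_of_tendsto_laplace (μ := μ) (b := fun y => y ^ α) (fun y hy => ?_) ?_
    fun n y hy => ?_
  · simp_rw [hμ _ y hy]
    -- The limit theorem concerns `(1 + g n)^n`, while the power here is `n + 1`; hence the shift.
    -- The truncated `n - 1` at `n = 0` plays no role.
    have h := Real.tendsto_one_add_pow_exp_of_tendsto (g := fun n => -(1 - φ (y * c (n - 1))))
      (t := -y ^ α) (by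
        rw [← tendsto_add_atTop_iff_nat 1]
        refine (hlim y hy).neg.congr fun n => ?_
        simp only [Nat.cast_add, Nat.cast_one, add_tsub_cancel_right]
        ring)
    rw [← tendsto_add_atTop_iff_nat 1] at h
    refine h.congr fun n => ?_
    simp
  · have h := (Real.continuousAt_rpow_const 0 α (Or.inr hα₀.le)).tendsto
    rw [Real.zero_rpow hα₀.ne'] at h
    exact h.mono_left nhdsWithin_le_nhds
  · rw [hμ n y hy.le]
    have hφ0 : 0 ≤ φ (y * c n) := div_nonneg (upperGamma_nonneg (mul_nonneg hy.le (c n).coe_nonneg))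
      (Real.Gamma_pos_of_pos hα₀).le
    -- Bernoulli's inequality gives `1 - φ^{n+1} ≤ (n + 1)(1 - φ) ≤ y^α`, uniformly in `n`.
    have h := one_add_mul_le_pow (a := φ (y * c n) - 1) (by linarith) (n + 1)
    have h2 := hup n y hy.le
    rw [add_sub_cancel] at h
    push_cast at h
    linarith

end Stable

/-! ### Uniqueness of multivariate Laplace transforms -/

section LaplaceUnique

variable {ι : Type*} [Fintype ι]

lemma exp_neg_sum_le_one (η x : ι → ℝ≥0) :
    ‖Real.exp (-∑ i, (η i : ℝ) * (x i : ℝ))‖ ≤ 1 := by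
  rw [Real.norm_eq_abs, abs_of_pos (Real.exp_pos _)]
  exact Real.exp_le_one_iff.2 (neg_nonpos.2 (Finset.sum_nonneg fun i _ => by positivity))

/-- The exponential `x ↦ e^{-∑ η_i x_i}` as a bounded continuous function on the octant. -/
noncomputable def expNegSum (η : ι → ℝ≥0) : (ι → ℝ≥0) →ᵇ ℝ :=
  BoundedContinuousFunction.ofNormedAddCommGroup
    (fun x => Real.exp (-∑ i, (η i : ℝ) * (x i : ℝ))) (by fun_prop) 1 (exp_neg_sum_le_one η)

lemma expNegSum_apply (η x : ι → ℝ≥0) :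
    expNegSum η x = Real.exp (-∑ i, (η i : ℝ) * (x i : ℝ)) := rfl

lemma expNegSum_add (η ξ : ι → ℝ≥0) : expNegSum (η + ξ) = expNegSum η * expNegSum ξ := by
  ext x
  simp only [expNegSum_apply, BoundedContinuousFunction.coe_mul, Pi.mul_apply]
  rw [← Real.exp_add, ← neg_add, ← Finset.sum_add_distrib]
  congr 2
  refine Finset.sum_congr rfl fun i _ => ?_
  simp [add_mul]

lemma expNegSum_zero : expNegSum (0 : ι → ℝ≥0) = 1 := by
  ext x
  simp [expNegSum_apply]

/-- The exponentials form a submonoid of the bounded continuous functions. -/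
noncomputable def expSubmonoid (ι : Type*) [Fintype ι] : Submonoid ((ι → ℝ≥0) →ᵇ ℝ) where
  carrier := range expNegSum
  mul_mem' := by
    rintro _ _ ⟨η, rfl⟩ ⟨ξ, rfl⟩
    exact ⟨η + ξ, expNegSum_add η ξ⟩
  one_mem' := ⟨0, expNegSum_zero⟩

/-- A finite measure on `[0, ∞)^ι` is determined by its Laplace transform. -/
theorem ext_of_laplace {μ ν : Measure (ι → ℝ≥0)} [IsFiniteMeasure μ] [IsFiniteMeasure ν]
    (h : ∀ η : ι → ℝ≥0, ∫ x, Real.exp (-∑ i, (η i : ℝ) * (x i : ℝ)) ∂μ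
      = ∫ x, Real.exp (-∑ i, (η i : ℝ) * (x i : ℝ)) ∂ν) : μ = ν := by
  classical
  -- A point-separating star subalgebra determines finite measures. Products of exponentials are
  -- exponentials, so elements of `A` are linear combinations of them and linearity suffices.
  let A : StarSubalgebra ℝ ((ι → ℝ≥0) →ᵇ ℝ) :=
    { Algebra.adjoin ℝ (expSubmonoid ι : Set ((ι → ℝ≥0) →ᵇ ℝ)) with
      star_mem' := fun {f} hf => by
        have : star f = f := by ext x; simp
        rwa [this] }
  have hmem : ∀ η, expNegSum η ∈ A := fun η =>
    Algebra.subset_adjoin (⟨η, rfl⟩ : expNegSum η ∈ (expSubmonoid ι : Set ((ι → ℝ≥0) →ᵇ ℝ)))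
  refine ext_of_forall_mem_subalgebra_integral_eq_of_polish (𝕜 := ℝ) (A := A) ?_ ?_
  · intro x y hxy
    obtain ⟨i, hi⟩ := Function.ne_iff.1 hxy
    refine ⟨_, ⟨_, ⟨_, hmem (Pi.single i 1), rfl⟩, rfl⟩, fun he => hi ?_⟩
    change expNegSum (Pi.single i 1) x = expNegSum (Pi.single i 1) y at he
    simp only [expNegSum_apply, Real.exp_eq_exp, neg_inj] at he
    rw [Finset.sum_eq_single i (fun j _ hj => by simp [Pi.single_eq_of_ne hj]) (by simp),
      Finset.sum_eq_single i (fun j _ hj => by simp [Pi.single_eq_of_ne hj]) (by simp)] at he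
    simpa using he
  · intro g hg
    have hg' : g ∈ Submodule.span ℝ (expSubmonoid ι : Set ((ι → ℝ≥0) →ᵇ ℝ)) := by
      have hsub := Algebra.adjoin_eq_span_of_subset (R := ℝ)
        (s := (expSubmonoid ι : Set ((ι → ℝ≥0) →ᵇ ℝ)))
        (by rw [Submonoid.closure_eq]; exact Submodule.subset_span)
      rw [← hsub]
      exact hg
    induction hg' using Submodule.span_induction with
    | mem f hf => obtain ⟨η, rfl⟩ := hf; exact h η
    | zero => simp
    | add f₁ f₂ h₁ h₂ e₁ e₂ =>
      simp only [BoundedContinuousFunction.coe_add, Pi.add_apply]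
      have hm : ∀ f ∈ Submodule.span ℝ (expSubmonoid ι : Set ((ι → ℝ≥0) →ᵇ ℝ)), f ∈ A :=
        fun f hf => Algebra.span_le_adjoin ℝ _ hf
      rw [integral_add (f₁.integrable μ) (f₂.integrable μ),
        integral_add (f₁.integrable ν) (f₂.integrable ν), e₁ (hm _ h₁), e₂ (hm _ h₂)]
    | smul c f hf e =>
      simp only [BoundedContinuousFunction.coe_smul]
      rw [integral_smul, integral_smul, e (Algebra.span_le_adjoin ℝ _ hf)]

end LaplaceUnique

/-! ### Construction of the finite-dimensional laws -/

section FiniteDimensionalLaws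

lemma increment_zero {n : ℕ} (t : Fin (n + 1) → ℝ) : increment t 0 = t 0 := by
  simp [increment]

lemma increment_nonneg {n : ℕ} {t : Fin n → ℝ} (ht₀ : ∀ k, 0 ≤ t k) (ht : Monotone t)
    (k : Fin n) : 0 ≤ increment t k := by
  cases n with
  | zero => exact k.elim0
  | succ n =>
    cases k using Fin.cases with
    | zero => simpa [increment_zero] using ht₀ 0
    | succ k =>
      rw [increment, ← Fin.succ_castSucc, Fin.cons_succ, sub_nonneg]
      exact ht (Fin.castSucc_lt_succ).le

/-- Summation by parts: weights on partial sums of increments become the tail sums in `Xi`. -/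
lemma sum_mul_sum_Iic {n : ℕ} (η a : Fin n → ℝ) :
    ∑ i, η i * ∑ k ∈ Finset.Iic i, a k = ∑ k, (∑ i ∈ Finset.Ici k, η i) * a k := by
  simp_rw [Finset.mul_sum, Finset.sum_mul]
  exact Finset.sum_comm' (by simp)

/-- The law of `X_i = U^{1/α} ∑_{k ≤ i} Δ_k^{1/α} S_k`, with independent stable `S_k` and an
independent random time change `U`. -/
theorem exists_law_of_increments {α ρ : ℝ} (hα₀ : 0 < α) (hα₁ : α < 1) (hρ₀ : 0 < ρ)
    (hρ₁ : ρ ≤ 1) {n : ℕ} (Δ : Fin n → ℝ≥0) :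
    ∃ π : Measure (Fin n → ℝ≥0), IsProbabilityMeasure π ∧ ∀ η : Fin n → ℝ≥0,
      ∫ x, Real.exp (-∑ k, (η k : ℝ) * (x k : ℝ)) ∂π
        = upperGamma ρ (∑ k, Xi α (fun i => (η i : ℝ)) k * Δ k) / Real.Gamma ρ := by
  obtain ⟨ν, hν, hνy⟩ := exists_measure_laplace_upperGamma_of_le_one hρ₀ hρ₁
  obtain ⟨σ, hσ, hσy⟩ := exists_stable hα₀ hα₁
  let X : ℝ≥0 × (Fin n → ℝ≥0) → Fin n → ℝ≥0 := fun q i =>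
    q.1 ^ α⁻¹ * ∑ k ∈ Finset.Iic i, Δ k ^ α⁻¹ * q.2 k
  have hX : Measurable X := by
    refine measurable_pi_lambda _ fun i => ?_
    fun_prop
  refine ⟨(ν.prod (Measure.pi fun _ => σ)).map X,
    Measure.isProbabilityMeasure_map hX.aemeasurable, fun η => ?_⟩
  have hcont : Continuous fun x : Fin n → ℝ≥0 => Real.exp (-∑ k, (η k : ℝ) * (x k : ℝ)) := by
    fun_prop
  rw [integral_map hX.aemeasurable hcont.aestronglyMeasurable, integral_prod]
  swap
  · exact Integrable.of_bound (hcont.measurable.comp hX).aestronglyMeasurable 1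
      (ae_of_all _ fun q => exp_neg_sum_le_one η (X q))
  have hH : ∀ k, 0 ≤ ∑ i ∈ Finset.Ici k, (η i : ℝ) := fun k =>
    Finset.sum_nonneg fun i _ => (η i).coe_nonneg
  have hS : 0 ≤ ∑ k, Xi α (fun i => (η i : ℝ)) k * Δ k :=
    Finset.sum_nonneg fun k _ => mul_nonneg (Real.rpow_nonneg (hH k) _) (Δ k).coe_nonneg
  -- Condition on `U = u`: the inner integral must be `e^{-uE}`, since the power `α` turns the scale
  -- `(u Δ_k)^{1/α}` into `u Δ_k`.
  rw [← hνy _ hS]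
  refine integral_congr_ae (ae_of_all _ fun u => ?_)
  have hfac : ∀ s : Fin n → ℝ≥0, Real.exp (-∑ k, (η k : ℝ) * (X (u, s) k : ℝ))
      = ∏ k, Real.exp (-(((∑ i ∈ Finset.Ici k, (η i : ℝ)) * ((u ^ α⁻¹ * Δ k ^ α⁻¹ : ℝ≥0) : ℝ))
        * s k)) := fun s => by
    rw [← Real.exp_sum, Finset.sum_neg_distrib]
    congr 2
    have h := sum_mul_sum_Iic (fun i => (η i : ℝ))
      (fun k => ((u ^ α⁻¹ * Δ k ^ α⁻¹ : ℝ≥0) : ℝ) * s k)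
    simp_rw [mul_assoc] at h ⊢
    rw [← h]
    refine Finset.sum_congr rfl fun i _ => ?_
    simp only [X]
    push_cast
    rw [Finset.mul_sum]
    simp_rw [mul_assoc]
  simp_rw [hfac]
  rw [integral_fintype_prod_eq_prod (fun (k : Fin n) (x : ℝ≥0) =>
    Real.exp (-(((∑ i ∈ Finset.Ici k, (η i : ℝ)) * ((u ^ α⁻¹ * Δ k ^ α⁻¹ : ℝ≥0) : ℝ)) * x)))]
  rw [Finset.prod_congr rfl fun k _ => hσy _ (mul_nonneg (hH k) (NNReal.coe_nonneg _)),
    ← Real.exp_sum, Finset.sum_neg_distrib, Finset.sum_mul]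
  congr 2
  refine Finset.sum_congr rfl fun k _ => ?_
  rw [Real.mul_rpow (hH k) (NNReal.coe_nonneg _), ← NNReal.mul_rpow, NNReal.coe_rpow,
    ← Real.rpow_mul (NNReal.coe_nonneg _), inv_mul_cancel₀ hα₀.ne', Real.rpow_one, Xi]
  push_cast
  ring

theorem exists_law {α ρ : ℝ} (hα₀ : 0 < α) (hα₁ : α < 1) (hρ₀ : 0 < ρ) (hρ₁ : ρ ≤ 1) {n : ℕ}
    {t : Fin n → ℝ} (ht₀ : ∀ k, 0 ≤ t k) (ht : Monotone t) :
    ∃ π : Measure (Fin n → ℝ≥0), IsProbabilityMeasure π ∧ ∀ η : Fin n → ℝ≥0,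
      ∫ x, Real.exp (-∑ k, (η k : ℝ) * (x k : ℝ)) ∂π = Phi α ρ t (fun k => (η k : ℝ)) := by
  obtain ⟨π, hπ, h⟩ := exists_law_of_increments hα₀ hα₁ hρ₀ hρ₁
    (fun k => (increment t k).toNNReal)
  refine ⟨π, hπ, fun η => ?_⟩
  rw [h η, Phi]
  simp_rw [Real.coe_toNNReal _ (increment_nonneg ht₀ ht _)]

lemma sum_Ici_eq_sum_ite {n : ℕ} (η : Fin n → ℝ) (k : Fin n) :
    ∑ i ∈ Finset.Ici k, η i = ∑ i, if k ≤ i then η i else 0 := by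
  rw [← Finset.sum_filter]
  congr 1
  ext i
  simp

lemma Xi_zero {n : ℕ} (α : ℝ) (η : Fin (n + 1) → ℝ) : Xi α η 0 = (∑ i, η i) ^ α := by
  simp [Xi]

lemma Xi_succ {n : ℕ} (α : ℝ) (η : Fin (n + 1) → ℝ) (k : Fin n) :
    Xi α η k.succ = Xi α (fun i => η i.succ) k := by
  simp [Xi, sum_Ici_eq_sum_ite, Fin.sum_univ_succ]

/-- The exponent in `Φ` is the integral over time of `(∑_{i : u ≤ t_i} η_i)^α`. -/
lemma sum_Xi_mul_sub {α : ℝ} (hα : 0 < α) {n : ℕ} (η : Fin n → ℝ) {t : Fin n → ℝ}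
    (ht : Monotone t) {b : ℝ} (hb : ∀ k, b ≤ t k) :
    IntegrableOn (fun u => (∑ i, if u ≤ t i then η i else 0) ^ α) (Ioi b) ∧
    ∑ k, Xi α η k * (t k - (Fin.cons b t : Fin (n + 1) → ℝ) k.castSucc)
      = ∫ u in Ioi b, (∑ i, if u ≤ t i then η i else 0) ^ α := by
  -- Peel off `(b, t 0]`, where all weights are present. Beyond it the first weight is gone and the
  -- remaining times start from `t 0`, hence the general `b`.
  induction n generalizing b with
  | zero => simp [Real.zero_rpow hα.ne']
  | succ n ih =>
    obtain ⟨hi, he⟩ := ih (fun i => η i.succ) (t := fun i => t i.succ)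
      (fun i j hij => ht (Fin.succ_le_succ_iff.2 hij)) (b := t 0) (fun k => ht (Fin.zero_le _))
    have h1 : EqOn (fun _ => (∑ i, η i) ^ α)
        (fun u => (∑ i, if u ≤ t i then η i else 0) ^ α) (Ioc b (t 0)) := fun u hu => by
      simp only
      congr 1
      exact Finset.sum_congr rfl fun i _ => (if_pos (hu.2.trans (ht (Fin.zero_le i)))).symm
    have h2 : EqOn (fun u => (∑ i : Fin n, if u ≤ t i.succ then η i.succ else 0) ^ α)
        (fun u => (∑ i, if u ≤ t i then η i else 0) ^ α) (Ioi (t 0)) := fun u hu => by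
      simp only
      rw [Fin.sum_univ_succ, if_neg (not_le.2 hu), zero_add]
    have i1 : IntegrableOn (fun u => (∑ i, if u ≤ t i then η i else 0) ^ α) (Ioc b (t 0)) :=
      (integrableOn_const (by simp)).congr_fun h1 measurableSet_Ioc
    have i2 := hi.congr_fun h2 measurableSet_Ioi
    have hu : Ioc b (t 0) ∪ Ioi (t 0) = Ioi b := Ioc_union_Ioi_eq_Ioi (hb 0)
    refine ⟨hu ▸ i1.union i2, ?_⟩
    rw [← hu, setIntegral_union (Ioc_disjoint_Ioi le_rfl) measurableSet_Ioi i1 i2,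
      ← setIntegral_congr_fun measurableSet_Ioc h1, ← setIntegral_congr_fun measurableSet_Ioi h2,
      ← he, Fin.sum_univ_succ, Xi_zero]
    congr 1
    · simp [hb 0, mul_comm]
    · refine Finset.sum_congr rfl fun k _ => ?_
      rw [Xi_succ, ← Fin.succ_castSucc, Fin.cons_succ,
        ← congrFun (Fin.cons_self_tail t) k.castSucc]
      rfl

lemma Phi_eq_integral {α ρ : ℝ} (hα : 0 < α) {n : ℕ} (η : Fin n → ℝ) {t : Fin n → ℝ}
    (ht₀ : ∀ k, 0 ≤ t k) (ht : Monotone t) :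
    Phi α ρ t η = upperGamma ρ (∫ u in Ioi 0, (∑ i, if u ≤ t i then η i else 0) ^ α)
      / Real.Gamma ρ := by
  rw [Phi, ← (sum_Xi_mul_sub hα η ht ht₀).2]
  rfl

end FiniteDimensionalLaws

/-! ### Complete monotonicity of Laplace transforms and smoothness of `Φ` -/

section LaplaceCompletelyMonotone

variable {Ω : Type*} [MeasurableSpace Ω] {n : ℕ}

lemma sum_update_mul (z x : Fin n → ℝ) (i : Fin n) (s : ℝ) :
    ∑ j, Function.update z i s j * x j = s * x i + ∑ j ∈ Finset.univ.erase i, z j * x j := by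
  rw [← Finset.add_sum_erase _ _ (Finset.mem_univ i), Function.update_self]
  congr 1
  refine Finset.sum_congr rfl fun j hj => ?_
  rw [Function.update_of_ne (Finset.ne_of_mem_erase hj)]

lemma update_mem_openOctant {z : Fin n → ℝ} (hz : z ∈ openOctant n) (i : Fin n) {s : ℝ}
    (hs : 0 < s) : Function.update z i s ∈ openOctant n := by
  intro j
  rcases eq_or_ne j i with rfl | hj
  · simpa using hs
  · simpa [hj] using hz j

/-- On the octant, `g` is `(-1)^s` times the Laplace transform of a positive measure of the form
`p dμ`, transported by `X`. -/
def IsSignedLaplace (μ : Measure Ω) (X : Ω → Fin n → ℝ) (s : ℕ) (g : (Fin n → ℝ) → ℝ) : Prop :=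
  ∃ p : Ω → ℝ, Measurable p ∧ (∀ a, 0 ≤ p a) ∧
    ∀ z ∈ openOctant n, Integrable (fun a => p a * Real.exp (-∑ i, z i * X a i)) μ ∧
      g z = (-1) ^ s * ∫ a, p a * Real.exp (-∑ i, z i * X a i) ∂μ

variable {μ : Measure Ω} {X : Ω → Fin n → ℝ}

lemma IsSignedLaplace.nonneg {s : ℕ} {g : (Fin n → ℝ) → ℝ} (h : IsSignedLaplace μ X s g)
    {z : Fin n → ℝ} (hz : z ∈ openOctant n) : 0 ≤ (-1) ^ s * g z := by
  obtain ⟨p, -, hp0, h⟩ := h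
  rw [(h z hz).2, ← mul_assoc, ← mul_pow, neg_one_mul, neg_neg, one_pow, one_mul]
  exact integral_nonneg fun a => mul_nonneg (hp0 a) (Real.exp_pos _).le

/-- Differentiating under the integral brings down `-X_i`: the sign flips once and the density `p
X_i` is still nonnegative, so the class is stable under iteration. -/
lemma IsSignedLaplace.partialDeriv (hX : Measurable X) (hX0 : ∀ a i, 0 ≤ X a i) {s : ℕ}
    {g : (Fin n → ℝ) → ℝ} (h : IsSignedLaplace μ X s g) (i : Fin n) :
    IsSignedLaplace μ X (s + 1) (partialDeriv i g) := by
  obtain ⟨p, hpm, hp0, h⟩ := h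
  refine ⟨fun a => p a * X a i, by fun_prop, fun a => mul_nonneg (hp0 a) (hX0 a i),
    fun z hz => ?_⟩
  have hzi : 0 < z i := hz i
  have hm : ∀ w : Fin n → ℝ, Measurable fun a => Real.exp (-∑ j, w j * X a j) := fun w => by
    fun_prop
  -- For `s > z_i / 2` the factor `X_i` is absorbed by `x ≤ (4 / z_i) e^{z_i x / 4}`. What remains
  -- is the integrand with `i`-th coordinate `z_i / 4`, integrable because that point is still in
  -- the octant.
  have key := hasDerivAt_integral_of_dominated_loc_of_deriv_le (μ := μ) (𝕜 := ℝ)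
    (F := fun s a => p a * Real.exp (-∑ j, Function.update z i s j * X a j))
    (F' := fun s a => -(p a * X a i * Real.exp (-∑ j, Function.update z i s j * X a j)))
    (x₀ := z i) (s := Ioi (z i / 2))
    (bound := fun a => 4 / z i *
      (p a * Real.exp (-∑ j, Function.update z i (z i / 4) j * X a j)))
    (Ioi_mem_nhds (by linarith))
    (Eventually.of_forall fun s => (hpm.mul (hm _)).aestronglyMeasurable)
    (by simpa using (h z hz).1)
    (((hpm.mul (by fun_prop)).mul (hm _)).neg.aestronglyMeasurable)
    (ae_of_all _ fun a s hs => ?_)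
    (((h _ (update_mem_openOctant hz i (by linarith))).1).const_mul _)
    (ae_of_all _ fun a s hs => ?_)
  · obtain ⟨hi, hd⟩ := key
    rw [Function.update_eq_self, integral_neg] at hd
    rw [Function.update_eq_self] at hi
    refine ⟨by simpa using hi.neg, ?_⟩
    have hd' := hd.const_mul ((-1 : ℝ) ^ s)
    have : HasDerivAt (fun s => g (Function.update z i s)) _ (z i) :=
      hd'.congr_of_eventuallyEq (by
        filter_upwards [Ioi_mem_nhds hzi] with r hr
        exact (h _ (update_mem_openOctant hz i hr)).2)
    rw [GenStable.partialDeriv, this.deriv, pow_succ]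
    ring
  · have hs : z i / 2 < s := hs
    have hx := hX0 a i
    have hp := hp0 a
    simp only [sum_update_mul]
    set r := ∑ j ∈ Finset.univ.erase i, z j * X a j
    rw [norm_neg, Real.norm_eq_abs, abs_of_nonneg (by positivity)]
    have h1 : X a i ≤ 4 / z i * Real.exp (z i / 4 * X a i) := by
      have := Real.add_one_le_exp (z i / 4 * X a i)
      rw [div_mul_eq_mul_div, le_div_iff₀ hzi]
      linarith
    have h2 : Real.exp (-(s * X a i + r)) ≤ Real.exp (-(z i / 2 * X a i + r)) :=
      Real.exp_le_exp.2 (by nlinarith)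
    calc p a * X a i * Real.exp (-(s * X a i + r))
        ≤ p a * (4 / z i * Real.exp (z i / 4 * X a i)) * Real.exp (-(z i / 2 * X a i + r)) := by
          gcongr
      _ = 4 / z i * (p a * (Real.exp (z i / 4 * X a i) * Real.exp (-(z i / 2 * X a i + r)))) := by
          ring
      _ = 4 / z i * (p a * Real.exp (-(z i / 4 * X a i + r))) := by
          rw [← Real.exp_add]
          congr 3; ring
  · simp only [sum_update_mul]
    have h1 := ((((hasDerivAt_id s).mul_const (X a i)).add_const
      (∑ j ∈ Finset.univ.erase i, z j * X a j)).neg.exp).const_mul (p a)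
    convert! h1 using 1
    simp
    ring

lemma IsSignedLaplace.iterate (hX : Measurable X) (hX0 : ∀ a i, 0 ≤ X a i) {s : ℕ}
    {g : (Fin n → ℝ) → ℝ} (h : IsSignedLaplace μ X s g) (i : Fin n) (k : ℕ) :
    IsSignedLaplace μ X (k + s) ((GenStable.partialDeriv i)^[k] g) := by
  induction k with
  | zero => simpa using h
  | succ k ih =>
    rw [Function.iterate_succ_apply', add_right_comm]
    exact ih.partialDeriv hX hX0 i

lemma IsSignedLaplace.mixedPartial (hX : Measurable X) (hX0 : ∀ a i, 0 ≤ X a i)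
    {g : (Fin n → ℝ) → ℝ} (h : IsSignedLaplace μ X 0 g) (k : Fin n → ℕ) :
    IsSignedLaplace μ X (∑ i, k i) (mixedPartial k g) := by
  rw [Fin.sum_univ_def, GenStable.mixedPartial]
  induction List.finRange n with
  | nil => simpa using h
  | cons i l ih => simpa using ih.iterate hX hX0 i (k i)

/-- A smooth function which is the Laplace transform of a finite measure is completely monotone. -/
theorem completelyMonotone_of_laplace [IsFiniteMeasure μ] (hX : Measurable X)
    (hX0 : ∀ a i, 0 ≤ X a i) {f : (Fin n → ℝ) → ℝ} (hf : ContDiffOn ℝ ∞ f (openOctant n))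
    (h : ∀ z ∈ openOctant n, f z = ∫ a, Real.exp (-∑ i, z i * X a i) ∂μ) :
    CompletelyMonotone f := by
  refine ⟨hf, fun k z hz => ?_⟩
  refine (IsSignedLaplace.mixedPartial (μ := μ) hX hX0 ⟨1, measurable_const, fun _ => zero_le_one,
    fun w hw => ⟨?_, by simpa using h w hw⟩⟩ k).nonneg hz
  refine Integrable.of_bound (Measurable.aestronglyMeasurable (by simp; fun_prop)) 1
    (ae_of_all _ fun a => ?_)
  rw [Pi.one_apply, one_mul, Real.norm_eq_abs, abs_of_pos (Real.exp_pos _)]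
  exact Real.exp_le_one_iff.2
    (neg_nonpos.2 (Finset.sum_nonneg fun i _ => mul_nonneg (hw i).le (hX0 a i)))

lemma contDiffOn_Phi {α ρ : ℝ} (hρ : 0 < ρ) {t : Fin n → ℝ}
    (ht₀ : ∀ k, 0 < t k) (ht : Monotone t) : ContDiffOn ℝ ∞ (Phi α ρ t) (openOctant n) := by
  have hpos : ∀ η ∈ openOctant n, ∀ k, 0 < ∑ i ∈ Finset.Ici k, η i := fun η hη k =>
    Finset.sum_pos (fun i _ => hη i) ⟨k, by simp⟩
  cases n with
  | zero =>
    exact (contDiff_const (c := Phi α ρ t 0)).contDiffOn.congr fun η _ => by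
      rw [Subsingleton.elim η 0]
  | succ n =>
    refine ContDiffOn.div_const ?_ _
    refine (contDiffOn_upperGamma hρ).comp (ContDiffOn.sum fun k _ => ?_) fun η hη => ?_
    · refine ContDiffOn.mul (fun η hη => ?_) contDiffOn_const
      exact ((Real.contDiffAt_rpow_const_of_ne (hpos η hη k).ne').comp η
        (f := fun η : Fin (n + 1) → ℝ => ∑ i ∈ Finset.Ici k, η i) (by fun_prop)).contDiffWithinAt
    -- Smoothness of `Γ(ρ; ·)` is available only away from `0`; the first increment, equal to the
    -- first time, makes the exponent strictly positive.
    · refine Finset.sum_pos' (fun k _ => mul_nonneg (Real.rpow_nonneg (hpos η hη k).le _)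
        (increment_nonneg (fun k => (ht₀ k).le) ht k)) ⟨0, Finset.mem_univ _, ?_⟩
      rw [increment_zero]
      exact mul_pos (Real.rpow_pos_of_pos (hpos η hη 0) _) (ht₀ 0)

end LaplaceCompletelyMonotone

/-! ### The projective family: existence and uniqueness -/

section ProcessLaws

/-- The exponent of the joint Laplace transform of `(X(s))_{s ∈ J}`. -/
noncomputable def timeExponent (α : ℝ) (J : Finset ℝ≥0) (ξ : J → ℝ≥0) : ℝ :=
  ∫ u in Ioi (0 : ℝ), (∑ j : J, if u ≤ ((j : ℝ≥0) : ℝ) then (ξ j : ℝ) else 0) ^ α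

/-- The joint Laplace transforms of the generalized stable process. -/
def HasLaplace (α ρ : ℝ) (J : Finset ℝ≥0) (μ : Measure (J → ℝ≥0)) : Prop :=
  ∀ ξ : J → ℝ≥0, ∫ x, Real.exp (-∑ j, (ξ j : ℝ) * (x j : ℝ)) ∂μ
    = upperGamma ρ (timeExponent α J ξ) / Real.Gamma ρ

variable {α ρ : ℝ}

lemma HasLaplace.unique {J : Finset ℝ≥0} {μ ν : Measure (J → ℝ≥0)} [IsFiniteMeasure μ]
    [IsFiniteMeasure ν] (hμ : HasLaplace α ρ J μ) (hν : HasLaplace α ρ J ν) : μ = ν :=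
  ext_of_laplace fun ξ => (hμ ξ).trans (hν ξ).symm

lemma sum_subtype_of_subset {I J : Finset ℝ≥0} (h : I ⊆ J) (f : J → ℝ)
    (hf : ∀ j : J, (j : ℝ≥0) ∉ I → f j = 0) : ∑ j, f j = ∑ i : I, f ⟨i, h i.2⟩ := by
  refine (Fintype.sum_of_injective (fun i : I => (⟨i, h i.2⟩ : J)) (fun i j hij => ?_) _ _
    (fun j hj => hf j fun hjI => hj ⟨⟨j, hjI⟩, rfl⟩) (fun _ => rfl)).symm
  exact Subtype.ext (congrArg (fun k : J => (k : ℝ≥0)) hij)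

/-- Zero weights contribute nothing, and the weight at time `0` never enters because the integral
runs over `u > 0`. This gives consistency and also handles time `0`. -/
lemma timeExponent_of_subset {I J : Finset ℝ≥0} (h : I ⊆ J) (ξ : J → ℝ≥0)
    (hξ : ∀ j : J, (j : ℝ≥0) ∉ I → (j : ℝ≥0) ≠ 0 → ξ j = 0) :
    timeExponent α J ξ = timeExponent α I fun i => ξ ⟨i, h i.2⟩ := by
  refine setIntegral_congr_fun measurableSet_Ioi fun u hu => ?_
  simp only
  rw [sum_subtype_of_subset h]
  intro j hj
  by_cases h0 : (j : ℝ≥0) = 0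
  · rw [h0]
    exact if_neg (not_le.2 hu)
  · simp [hξ j hj h0]

lemma timeExponent_eq_of_equiv {n : ℕ} {J : Finset ℝ≥0} (e : Fin n ≃ J)
    (he : Monotone fun k => (e k : ℝ≥0)) (hα : 0 < α) (ξ : J → ℝ≥0) :
    Phi α ρ (fun k => ((e k : ℝ≥0) : ℝ)) (fun k => (ξ (e k) : ℝ))
      = upperGamma ρ (timeExponent α J ξ) / Real.Gamma ρ := by
  rw [Phi_eq_integral hα _ (fun k => NNReal.coe_nonneg _)
    (fun i j hij => NNReal.coe_le_coe.2 (he hij)), timeExponent]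
  simp_rw [← e.sum_comp]

/-- The enumeration of the times `t_1 < ⋯ < t_n`. -/
noncomputable def imageEquiv {n : ℕ} {t : Fin n → ℝ≥0} (ht : StrictMono t) :
    Fin n ≃ (Finset.univ.image t : Finset ℝ≥0) :=
  Equiv.ofBijective (fun k => ⟨t k, Finset.mem_image_of_mem t (Finset.mem_univ k)⟩)
    ⟨fun i j hij => ht.injective (congrArg Subtype.val hij), fun ⟨j, hj⟩ => by
      obtain ⟨k, -, rfl⟩ := Finset.mem_image.1 hj
      exact ⟨k, rfl⟩⟩

lemma exists_hasLaplace (hα₀ : 0 < α) (hα₁ : α < 1) (hρ₀ : 0 < ρ) (hρ₁ : ρ ≤ 1)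
    (J : Finset ℝ≥0) : ∃ μ : Measure (J → ℝ≥0), IsProbabilityMeasure μ ∧ HasLaplace α ρ J μ := by
  let e := (J.orderIsoOfFin rfl)
  have he : Monotone fun k => (e k : ℝ≥0) := fun i j hij => e.monotone hij
  obtain ⟨π, hπ, h⟩ := exists_law hα₀ hα₁ hρ₀ hρ₁ (t := fun k => ((e k : ℝ≥0) : ℝ))
    (fun k => NNReal.coe_nonneg _) (fun i j hij => NNReal.coe_le_coe.2 (he hij))
  have hm : Measurable fun (x : Fin J.card → ℝ≥0) (j : J) => x (e.symm j) :=
    measurable_pi_lambda _ fun j => measurable_pi_apply _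
  refine ⟨π.map fun x j => x (e.symm j), Measure.isProbabilityMeasure_map hm.aemeasurable,
    fun ξ => ?_⟩
  rw [integral_map hm.aemeasurable (Continuous.aestronglyMeasurable (by fun_prop))]
  refine Eq.trans ?_ ((h fun k => ξ (e k)).trans (timeExponent_eq_of_equiv e.toEquiv he hα₀ ξ))
  simp_rw [← e.toEquiv.sum_comp]
  simp

lemma integral_map_restrict₂ {I J : Finset ℝ≥0} (h : I ⊆ J) (μ : Measure (J → ℝ≥0))
    (ξ : I → ℝ≥0) :
    ∫ x, Real.exp (-∑ j, (ξ j : ℝ) * (x j : ℝ))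
        ∂(μ.map (Finset.restrict₂ (π := fun _ : ℝ≥0 => ℝ≥0) h))
      = ∫ x, Real.exp (-∑ i : I, (ξ i : ℝ) * (x ⟨i, h i.2⟩ : ℝ)) ∂μ :=
  integral_map (φ := fun (x : J → ℝ≥0) (i : I) => x ⟨i, h i.2⟩)
    (measurable_pi_lambda _ fun _ => measurable_pi_apply _).aemeasurable
    (Continuous.aestronglyMeasurable (by fun_prop))

lemma HasLaplace.map_restrict {I J : Finset ℝ≥0} (h : I ⊆ J)
    {μ : Measure (J → ℝ≥0)} (hμ : HasLaplace α ρ J μ) :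
    HasLaplace α ρ I (μ.map (Finset.restrict₂ (π := fun _ : ℝ≥0 => ℝ≥0) h)) := by
  classical
  intro ξ
  rw [integral_map_restrict₂]
  -- Passing to a marginal amounts to extending the weights by zero.
  let ξ' : J → ℝ≥0 := fun j => if hj : (j : ℝ≥0) ∈ I then ξ ⟨j, hj⟩ else 0
  have h0 : ∀ j : J, (j : ℝ≥0) ∉ I → ξ' j = 0 := fun j hj => dif_neg hj
  have h1 : ∀ i : I, ξ' ⟨i, h i.2⟩ = ξ i := fun i => dif_pos i.2
  have h2 := hμ ξ'
  rw [timeExponent_of_subset h ξ' fun j hj _ => h0 j hj] at h2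
  simp_rw [h1] at h2
  rw [← h2]
  refine integral_congr_ae (ae_of_all _ fun x => ?_)
  simp only
  rw [sum_subtype_of_subset h _ fun j hj => by simp [h0 j hj]]
  simp_rw [h1]

lemma isGenStableLaws_of_hasLaplace (hα : 0 < α) (hρ : 0 < ρ)
    {P : ∀ J : Finset ℝ≥0, Measure (J → ℝ≥0)} (hP : ∀ J, IsProbabilityMeasure (P J))
    (h : ∀ J, HasLaplace α ρ J (P J)) : IsGenStableLaws α ρ P := by
  have hG := Real.Gamma_pos_of_pos hρ
  refine ⟨hP, fun I J hJI => ?_, ?_, fun n t ht₀ ht η => ?_⟩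
  · have := Measure.isProbabilityMeasure_map (μ := P I)
      (Finset.measurable_restrict₂ (X := fun _ : ℝ≥0 => ℝ≥0) hJI).aemeasurable
    exact (h J).unique ((h I).map_restrict hJI)
  · have hd : P {0} = Measure.dirac 0 := by
      refine (h {0}).unique fun ξ => ?_
      have h0 : timeExponent α {0} ξ = 0 := by
        rw [timeExponent_of_subset (Finset.empty_subset _) ξ fun j _ hj =>
          absurd (Finset.mem_singleton.1 j.2) hj]
        simp [timeExponent, Real.zero_rpow hα.ne']
      rw [h0, upperGamma_zero hρ, div_self hG.ne', integral_dirac]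
      simp
    rw [hd, ae_dirac_iff (measurableSet_eq_fun (measurable_pi_apply _) measurable_const)]
    rfl
  · let e := imageEquiv ht
    have h1 := h _ (fun j => η (e.symm j))
    rw [← timeExponent_eq_of_equiv e ht.monotone hα] at h1
    simp_rw [← e.sum_comp, Equiv.symm_apply_apply] at h1
    exact h1

lemma IsGenStableLaws.hasLaplace_of_notMem (hα : 0 < α)
    {P : ∀ J : Finset ℝ≥0, Measure (J → ℝ≥0)} (hP : IsGenStableLaws α ρ P) {J : Finset ℝ≥0}
    (hJ : 0 ∉ J) : HasLaplace α ρ J (P J) := by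
  obtain ⟨n, t, ht₀, ht, rfl⟩ : ∃ (n : ℕ) (t : Fin n → ℝ≥0), (∀ k, 0 < t k) ∧ StrictMono t ∧
      J = Finset.univ.image t := by
    refine ⟨J.card, J.orderEmbOfFin rfl, fun k => pos_iff_ne_zero.2 fun hk => hJ ?_,
      (J.orderEmbOfFin rfl).strictMono, (J.image_orderEmbOfFin_univ rfl).symm⟩
    rw [← hk]
    exact J.orderEmbOfFin_mem rfl k
  let e := imageEquiv ht
  intro ξ
  rw [← timeExponent_eq_of_equiv e ht.monotone hα]
  simp_rw [← e.sum_comp]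
  exact hP.laplace n t ht₀ ht fun k => ξ (e k)

/-- The Laplace condition covers positive times only. If `0 ∈ J`, consistency and `X(0) = 0` almost
surely reduce to `J.erase 0`. -/
lemma IsGenStableLaws.hasLaplace (hα : 0 < α)
    {P : ∀ J : Finset ℝ≥0, Measure (J → ℝ≥0)} (hP : IsGenStableLaws α ρ P) (J : Finset ℝ≥0) :
    HasLaplace α ρ J (P J) := by
  by_cases hJ : 0 ∈ J
  swap
  · exact hP.hasLaplace_of_notMem hα hJ
  intro ξ
  have hz : ∀ᵐ x ∂(P J), x ⟨0, hJ⟩ = 0 := by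
    have h0 := hP.zero
    rw [hP.consistent J {0} (Finset.singleton_subset_iff.2 hJ)] at h0
    exact ae_of_ae_map (Finset.measurable_restrict₂ _).aemeasurable h0
  have hsub := J.erase_subset 0
  have h1 := hP.hasLaplace_of_notMem hα (J.notMem_erase 0) fun i => ξ ⟨i, hsub i.2⟩
  have hmem : ∀ j : J, (j : ℝ≥0) ∉ J.erase 0 → (j : ℝ≥0) = 0 := fun j hj => by
    simpa using hj
  rw [timeExponent_of_subset hsub ξ fun j hj hj0 => absurd (hmem j hj) hj0, ← h1,
    hP.consistent J _ hsub, integral_map_restrict₂]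
  refine integral_congr_ae (hz.mono fun x hx => ?_)
  simp only
  rw [sum_subtype_of_subset hsub]
  intro j hj
  have : j = ⟨0, hJ⟩ := Subtype.ext (hmem j hj)
  rw [this, hx]
  simp

theorem existsUnique_isGenStableLaws (hα₀ : 0 < α) (hα₁ : α < 1) (hρ₀ : 0 < ρ) (hρ₁ : ρ ≤ 1) :
    ∃! P : ∀ J : Finset ℝ≥0, Measure (J → ℝ≥0), IsGenStableLaws α ρ P := by
  choose P hP hL using exists_hasLaplace hα₀ hα₁ hρ₀ hρ₁
  refine ⟨P, isGenStableLaws_of_hasLaplace hα₀ hρ₀ hP hL, fun Q hQ => funext fun J => ?_⟩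
  have := hQ.isProbabilityMeasure J
  exact (hQ.hasLaplace hα₀ J).unique (hL J)

end ProcessLaws

/-! ### The one-dimensional criterion `αρ ≤ 1` -/

section OneDimensional

variable {α ρ t : ℝ}

lemma Phi_one (η : Fin 1 → ℝ) :
    Phi α ρ (fun _ : Fin 1 => t) η = upperGamma ρ (t * η 0 ^ α) / Real.Gamma ρ := by
  rw [Phi, Fin.sum_univ_one, increment_zero, Xi_zero, Fin.sum_univ_one, mul_comm]

lemma completelyMonotone_Phi_one (hα₀ : 0 < α) (hα₁ : α < 1) (hρ : 0 < ρ) (ht : 0 < t)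
    (hαρ : α * ρ ≤ 1) : CompletelyMonotone (Phi α ρ (fun _ : Fin 1 => t)) := by
  obtain ⟨σ, hσ, hσy⟩ := exists_stable hα₀ hα₁
  -- Scaling by `t^{1/α}` turns the transform `e^{-y^α}` into `e^{-t y^α}`.
  have hτ : IsProbabilityMeasure (σ.map fun x => (t ^ α⁻¹).toNNReal * x) :=
    Measure.isProbabilityMeasure_map (by fun_prop)
  have htp : 0 ≤ t ^ α⁻¹ := Real.rpow_nonneg ht.le _
  obtain ⟨m, hm, hmy⟩ := exists_measure_laplace_upperGamma hα₀ hρ ht hαρ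
    (τ := σ.map fun x => (t ^ α⁻¹).toNNReal * x) (fun y hy => by
      rw [integral_map (by fun_prop) (by fun_prop)]
      have h := hσy (y * t ^ α⁻¹) (by positivity)
      rw [Real.mul_rpow hy.le htp, ← Real.rpow_mul ht.le, inv_mul_cancel₀ hα₀.ne',
        Real.rpow_one, mul_comm (y ^ α)] at h
      rw [← h]
      simp only [NNReal.coe_mul, Real.coe_toNNReal _ htp, mul_assoc])
  refine completelyMonotone_of_laplace (μ := m) (X := fun x _ => (x : ℝ)) (by fun_prop)
    (fun x _ => x.coe_nonneg) (contDiffOn_Phi hρ (fun _ => ht) fun _ _ _ => le_rfl) fun z hz => ?_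
  rw [Phi_one, ← hmy _ (hz 0).le]
  simp

lemma partialDeriv_one {f : (Fin 1 → ℝ) → ℝ} {h : ℝ → ℝ} (hf : ∀ z ∈ openOctant 1, f z = h (z 0))
    {z : Fin 1 → ℝ} (hz : z ∈ openOctant 1) : partialDeriv 0 f z = deriv h (z 0) := by
  refine Filter.EventuallyEq.deriv_eq ?_
  filter_upwards [Ioi_mem_nhds (hz 0)] with s hs
  rw [hf _ (update_mem_openOctant hz 0 hs), Function.update_self]

lemma mul_le_one_of_completelyMonotone (hα₀ : 0 < α) (hρ : 0 < ρ) (ht : 0 < t)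
    (hcm : CompletelyMonotone (Phi α ρ (fun _ : Fin 1 => t))) : α * ρ ≤ 1 := by
  by_contra! hlt
  have hG := Real.Gamma_pos_of_pos hρ
  set C := α * t ^ ρ / Real.Gamma ρ
  have hC : 0 < C := by positivity
  -- The second derivative has the sign of `t α y^α - (αρ - 1)`; this `y` makes `t α y^α` half of
  -- `αρ - 1`, so the sign is negative.
  set y : ℝ := ((α * ρ - 1) / (2 * (α * t))) ^ α⁻¹
  have hb : 0 < (α * ρ - 1) / (2 * (α * t)) := div_pos (by linarith) (by positivity)
  have hy : 0 < y := Real.rpow_pos_of_pos hb _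
  have hyα : y ^ α = (α * ρ - 1) / (2 * (α * t)) := by
    rw [← Real.rpow_mul hb.le, inv_mul_cancel₀ hα₀.ne', Real.rpow_one]
  have h := hcm.sign (fun _ => 2) (fun _ => y) (fun _ => hy)
  have hmix : mixedPartial (fun _ : Fin 1 => 2) (Phi α ρ (fun _ : Fin 1 => t)) (fun _ => y)
      = deriv (fun y => -(C * (Real.exp (-(t * y ^ α)) * y ^ (α * ρ - 1)))) y := by
    refine partialDeriv_one (f := partialDeriv 0 (Phi α ρ fun _ : Fin 1 => t)) (fun z hz => ?_)
      (fun _ => hy)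
    rw [partialDeriv_one (h := fun y => upperGamma ρ (t * y ^ α) / Real.Gamma ρ)
      (fun z _ => Phi_one z) hz, ((hasDerivAt_upperGamma_rpow hρ ht (hz 0)).div_const _).deriv]
    ring
  have hd : HasDerivAt (fun y => -(C * (Real.exp (-(t * y ^ α)) * y ^ (α * ρ - 1))))
      (-(C * Real.exp (-(t * y ^ α)) * y ^ (α * ρ - 2) * ((α * ρ - 1) - t * α * y ^ α))) y := by
    have h1 := (((((Real.hasDerivAt_rpow_const (p := α) (Or.inl hy.ne')).const_mul t).neg.exp).mul
      (Real.hasDerivAt_rpow_const (p := α * ρ - 1) (Or.inl hy.ne'))).const_mul C).neg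
    convert! h1 using 1
    have e1 : y ^ (α * ρ - 1) = y ^ (α * ρ - 2) * y := by
      rw [← Real.rpow_add_one hy.ne']; congr 1; ring
    have e2 : y ^ α = y ^ (α - 1) * y := by
      rw [← Real.rpow_add_one hy.ne', sub_add_cancel]
    have e3 : α * ρ - 1 - 1 = α * ρ - 2 := by ring
    simp only [Pi.neg_apply]
    rw [e3, e1]
    nth_rewrite 2 [e2]
    ring
  rw [hmix, hd.deriv] at h
  have hpos : 0 < C * Real.exp (-(t * y ^ α)) * y ^ (α * ρ - 2) := by positivity
  have hfac : (α * ρ - 1) - t * α * y ^ α = (α * ρ - 1) / 2 := by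
    rw [hyα]
    field_simp
    ring
  rw [hfac] at h
  have h2 : 0 < (α * ρ - 1) / 2 := by linarith
  have h3 := mul_pos hpos h2
  simp only [Fin.sum_univ_one, even_two, Even.neg_pow, one_pow, one_mul] at h
  linarith

end OneDimensional

end GenStable

theorem lemma3p1 (α : ℝ) (hα₀ : 0 < α) (hα₁ : α < 1) :
    (∀ ρ : ℝ, 0 < ρ → ρ ≤ 1 →
      (∀ (n : ℕ) (t : Fin n → ℝ), (∀ k, 0 < t k) → StrictMono t →
        ContDiffOn ℝ ∞ (GenStable.Phi α ρ t) (GenStable.openOctant n) ∧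
        GenStable.Phi α ρ t 0 = 1 ∧
        GenStable.CompletelyMonotone (GenStable.Phi α ρ t) ∧
        ∃! π : ProbabilityMeasure (Fin n → ℝ≥0), ∀ η : Fin n → ℝ≥0,
          GenStable.Phi α ρ t (fun k => (η k : ℝ)) =
            ∫ x, Real.exp (-∑ k, (η k : ℝ) * (x k : ℝ)) ∂(π : Measure (Fin n → ℝ≥0))) ∧
      ∃! P : ∀ J : Finset ℝ≥0, Measure (J → ℝ≥0), GenStable.IsGenStableLaws α ρ P) ∧
    (∀ ρ : ℝ, 0 < ρ → ∀ t : ℝ, 0 < t →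
      (GenStable.CompletelyMonotone (GenStable.Phi α ρ (fun _ : Fin 1 => t)) ↔ α * ρ ≤ 1)) := by
  refine ⟨fun ρ hρ₀ hρ₁ => ⟨fun n t ht₀ ht => ?_,
    GenStable.existsUnique_isGenStableLaws hα₀ hα₁ hρ₀ hρ₁⟩, fun ρ hρ t ht =>
    ⟨GenStable.mul_le_one_of_completelyMonotone hα₀ hρ ht,
      GenStable.completelyMonotone_Phi_one hα₀ hα₁ hρ ht⟩⟩
  have hsmooth := GenStable.contDiffOn_Phi (α := α) hρ₀ ht₀ ht.monotone
  obtain ⟨π, hπ, h⟩ := GenStable.exists_law hα₀ hα₁ hρ₀ hρ₁ (fun k => (ht₀ k).le) ht.monotone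
  refine ⟨hsmooth, ?_, ?_, ⟨π, hπ⟩, fun η => (h η).symm, fun π' hπ' => ?_⟩
  · have h0 := (h 0).symm
    simp only [Pi.zero_apply, NNReal.coe_zero, zero_mul, Finset.sum_const_zero, neg_zero,
      Real.exp_zero, integral_const, probReal_univ, one_smul] at h0
    exact h0
  · refine GenStable.completelyMonotone_of_laplace (μ := π) (X := fun x k => (x k : ℝ))
      (by fun_prop) (fun x k => (x k).coe_nonneg) hsmooth fun z hz => ?_
    have h1 := h fun k => (z k).toNNReal
    simp_rw [Real.coe_toNNReal _ (hz _).le] at h1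
    exact h1.symm
  · have : IsProbabilityMeasure (π' : Measure (Fin n → ℝ≥0)) := π'.2
    exact Subtype.ext (GenStable.ext_of_laplace (μ := (π' : Measure (Fin n → ℝ≥0))) (ν := π)
      fun η => (hπ' η).symm.trans (h η).symm)
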